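/- **Setting.** Let $Ag=\{1,\dots,n\}$ be a finite set of agents, $Var=\{p_1,p_2,\dots\}$ a countable set of propositional variables, and let $\mathcal L_{\mathsf{Xstit}}$ be the language, in negation normal form, $$\phi ::= p \mid \overline p \mid \phi\wedge\phi \mid \phi\vee\phi \mid \Box\phi \mid \Diamond\phi \mid [A]^x\phi \mid \langle A\rangle^x\phi \mid [X]\phi \mid \langle X\rangle\phi \qquad (p\in Var,\ A\subseteq Ag).$$ **Semantics.** A relational $\mathsf{Xstit}$-frame is a non-empty set $W$ with binary relations $\mathcal R_\Box$, $\mathcal R_X$ and $\mathcal R_A$ ($A\subseteq Ag$) such that: $\mathcal R_\Box$ is an equivalence relation; $\mathcal R_X$ is serial and deterministic; $\mathcal R_\emptyset wu$ iff $\exists v\,(\mathcal R_\Box wv\wedge \mathcal R_Xvu)$; $\mathcal R_{Ag} wu$ iff $\exists v\,(\mathcal R_X wv\wedge \mathcal R_\Box vu)$; $\mathcal R_A\subseteq\mathcal R_B$ whenever $B\subseteq A\subseteq Ag$; and, for all $A,B\subseteq Ag$ with $A\cap B=\emptyset$ and all $w_1,w_2,w_3\in W$ with $\mathcal R_\Box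 w_1w_2$ and $\mathcal R_\Box w_1w_3$, there is $w_4$ with $\mathcal R_\Box w_1w_4$ such that for all $w_5,w_6\in W$: $\mathcal R_Aw_4w_5\to\mathcal R_Aw_2w_5$ and $\mathcal R_Bw_4w_6\to\mathcal R_Bw_3w_6$. A model adds a valuation $V:Var\to\mathcal P(W)$. Satisfaction is as usual: $w\models p$ iff $w\in V(p)$, $w\models\overline p$ iff $w\notin V(p)$, $\wedge,\vee$ are Boolean, and $\Box,[X],[A]^x$ (resp. $\Diamond,\langle X\rangle,\langle A\rangle^x$) quantify universally (resp. existentially) over $\mathcal R_\Box,\mathcal R_X,\mathcal R_A$-successors. $\phi$ is valid, $\models\phi$, iff it holds at every world of every model. **The calculus $\mathsf{G3Xstit}$.** Let $L$ be a countably infinite set of labels. Sequents are finite multisets of relational atoms $\mathcal R_\alpha xy$ ($\alpha\in\{\Box,X\}\cup\mathcal P(Ag)$), equalities $x=y$, and labelled formulae $x:\phi$, with $x,y\in L$. The rules, written "premise(s) $/$ conclusion", are as follows; $v^\ast$ means that $v$ is an eigenvariable (it does not occur in the conclusion and is distinct from the other labels displayed in the rule), and $\alpha$ ranges over $\Box$,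 $X$ and all $A\subseteq Ag$, with $[\alpha],\langle\alpha\rangle$ the corresponding box and diamond. * $(\mathsf{id})$: $\ /\ \Gamma,w:p,w:\overline p$. * $(\wedge)$: $\Gamma,w:\phi$ and $\Gamma,w:\psi\ /\ \Gamma,w:\phi\wedge\psi$. $(\vee)$: $\Gamma,w:\phi,w:\psi\ /\ \Gamma,w:\phi\vee\psi$. * $([\alpha])$: $\Gamma,\mathcal R_\alpha wv,v:\phi\ /\ \Gamma,w:[\alpha]\phi$, with $v^\ast$. $(\langle\alpha\rangle)$: $\Gamma,\mathcal R_\alpha wu,w:\langle\alpha\rangle\phi,u:\phi\ /\ \Gamma,\mathcal R_\alpha wu,w:\langle\alpha\rangle\phi$. * $(\mathsf{refl}_=)$: $w=w,\Gamma\ /\ \Gamma$. $(\mathsf{eucl}_=)$: $w=u,w=v,u=v,\Gamma\ /\ w=u,w=v,\Gamma$. $(\mathsf{sub}_=)$: $w=u,\Delta[w],\Delta[u],\Gamma\ /\ w=u,\Delta[w],\Gamma$, where $\Delta[w]$ is a multiset of relational atoms and labelled formulae and $\Delta[u]$ results from it by replacing every $w$ by $u$. * $(\mathsf{refl}_\Box)$: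 $\mathcal R_\Box ww,\Gamma\ /\ \Gamma$. $(\mathsf{eucl}_\Box)$: $\mathcal R_\Box wu,\mathcal R_\Box wv,\mathcal R_\Box uv,\Gamma\ /\ \mathcal R_\Box wu,\mathcal R_\Box wv,\Gamma$. * $(\mathsf{ser}_X)$: $\mathcal R_Xwv,\Gamma\ /\ \Gamma$, with $v^\ast$. $(\mathsf{det}_X)$: $v=u,\mathcal R_Xwv,\mathcal R_Xwu,\Gamma\ /\ \mathcal R_Xwv,\mathcal R_Xwu,\Gamma$. * $(\mathsf{Eff}\emptyset)$: $\mathcal R_\Box wv,\mathcal R_Xvu,\mathcal R_\emptyset wu,\Gamma\ /\ \mathcal R_\Box wv,\mathcal R_Xvu,\Gamma$. $(\emptyset\mathsf{Eff})$: $\mathcal R_\Box wv,\mathcal R_Xvu,\mathcal R_\emptyset wu,\Gamma\ /\ \mathcal R_\emptyset wu,\Gamma$, with $v^\ast$. * $(\mathsf{EffAg})$: $\mathcal R_{Ag}wu,\mathcal R_Xwv,\mathcal R_\Box vu,\Gamma\ /\ \mathcal R_Xwv,\mathcal R_\Box vu,\Gamma$. $(\mathsf{AgEff})$: $\mathcal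 R_{Ag}wu,\mathcal R_Xwv,\mathcal R_\Box vu,\Gamma\ /\ \mathcal R_{Ag}wu,\Gamma$, with $v^\ast$. * $(\mathsf{C\text{-}Mon})$: $\mathcal R_Awv,\mathcal R_Bwv,\Gamma\ /\ \mathcal R_Awv,\Gamma$ for $B\subseteq A\subseteq Ag$. * The system of rules $(\mathsf{IOA}_X)$; an instance is given by $A,B\subseteq Ag$ with $A\cap B=\emptyset$ and labels $w_2,w_3,w_4$: $(\mathsf{IOA\text{-}E})$: $\mathcal R_\Box w_1w_2,\mathcal R_\Box w_1w_3,\mathcal R_\Box w_1w_4,\Gamma\ /\ \mathcal R_\Box w_1w_2,\mathcal R_\Box w_1w_3,\Gamma$, with $w_4^\ast$; $(\mathsf{IOA\text{-}U_1})$: $\mathcal R_Aw_4w_5,\mathcal R_Aw_2w_5,\Gamma\ /\ \mathcal R_Aw_4w_5,\Gamma$; $(\mathsf{IOA\text{-}U_2})$: $\mathcal R_Bw_4w_6,\mathcal R_Bw_3w_6,\Gamma\ /\ \mathcal R_Bw_4w_6,\Gamma$. $(\mathsf{IOA\text{-}E})$ may be used anywhere. Every application of $(\mathsf{IOA\text{-}U_1})$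 or $(\mathsf{IOA\text{-}U_2})$ must lie above an application of $(\mathsf{IOA\text{-}E})$ belonging to the same instance, and if one of the two rules is used above that application of $(\mathsf{IOA\text{-}E})$, then so is the other. In addition (closure condition), if an instance of one of these rules has two coinciding relational atoms or equalities among its displayed principal ones, the instance in which the duplicates are contracted is also a rule. A sequent is derivable if it is the end sequent of a finite derivation tree that meets these conditions. Write $\vdash_{\mathsf{G3Xstit}}x:\phi$ if the sequent consisting of $x:\phi$ alone is derivable. **Corollary (Completeness of $\mathsf{G3Xstit}$).** For all $\phi\in\mathcal L_{\mathsf{Xstit}}$ and every label $x$: if $\models\phi$, then $\vdash_{\mathsf{G3Xstit}}x:\phi$. -/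

import Mathlib

namespace Xstit

/-- Indices of the modalities and of the accessibility relations: settledness, next state, and one
index for every group `A ⊆ Ag`, where `Ag = Fin n`. -/
inductive Index (n : ℕ) : Type
  | box : Index n
  | next : Index n
  | stit (A : Finset (Fin n)) : Index n

/-- Formulae in negation normal form over the propositional variables `p₀, p₁, …`. The formulae
`nec α φ` are `□φ`, `[X]φ`, `[A]ˣφ`, and `poss α φ` are `◇φ`, `⟨X⟩φ`, `⟨A⟩ˣφ`. -/
inductive Formula (n : ℕ) : Type
  | var (p : ℕ) : Formula n
  | nvar (p : ℕ) : Formula n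
  | and (φ ψ : Formula n) : Formula n
  | or (φ ψ : Formula n) : Formula n
  | nec (α : Index n) (φ : Formula n) : Formula n
  | poss (α : Index n) (φ : Formula n) : Formula n

/-- Relational Xstit-frames with set of worlds `W`. -/
structure Frame (n : ℕ) (W : Type) where
  R : Index n → W → W → Prop
  nonempty : Nonempty W
  box_equiv : Equivalence (R .box)
  next_serial : ∀ w, ∃ v, R .next w v
  next_det : ∀ w v u, R .next w v → R .next w u → v = u
  empty_iff : ∀ w u, R (.stit ∅) w u ↔ ∃ v, R .box w v ∧ R .next v u
  grand_iff : ∀ w u, R (.stit Finset.univ) w u ↔ ∃ v, R .next w v ∧ R .box v u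
  mono : ∀ A B : Finset (Fin n), B ⊆ A → ∀ w u, R (.stit A) w u → R (.stit B) w u
  indep : ∀ A B : Finset (Fin n), Disjoint A B → ∀ w₁ w₂ w₃,
    R .box w₁ w₂ → R .box w₁ w₃ →
      ∃ w₄, R .box w₁ w₄ ∧ (∀ w₅, R (.stit A) w₄ w₅ → R (.stit A) w₂ w₅) ∧
        (∀ w₆, R (.stit B) w₄ w₆ → R (.stit B) w₃ w₆)

/-- Satisfaction of a formula at a world of the model `(F, V)`. -/
def Sat {n : ℕ} {W : Type} (F : Frame n W) (V : ℕ → Set W) : W → Formula n → Prop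
  | w, .var p => w ∈ V p
  | w, .nvar p => w ∉ V p
  | w, .and φ ψ => Sat F V w φ ∧ Sat F V w ψ
  | w, .or φ ψ => Sat F V w φ ∨ Sat F V w ψ
  | w, .nec α φ => ∀ u, F.R α w u → Sat F V u φ
  | w, .poss α φ => ∃ u, F.R α w u ∧ Sat F V u φ

/-- Validity: truth at every world of every relational Xstit-model. -/
def Valid {n : ℕ} (φ : Formula n) : Prop :=
  ∀ (W : Type) (F : Frame n W) (V : ℕ → Set W) (w : W), Sat F V w φ

/-- The countably infinite set of labels. -/
abbrev Label := ℕ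

/-- Constituents of labelled sequents: relational atoms `R_α x y`, equalities `x = y`, and labelled
formulae `x : φ`. -/
inductive Item (n : ℕ) : Type
  | rel (α : Index n) (x y : Label) : Item n
  | eq (x y : Label) : Item n
  | fml (x : Label) (φ : Formula n) : Item n

/-- Labelled sequents are finite multisets. -/
abbrev Sequent (n : ℕ) := Multiset (Item n)

/-- The label `v` occurs in an item. -/
def Item.Has {n : ℕ} (v : Label) : Item n → Prop
  | .rel _ x y => v = x ∨ v = y
  | .eq x y => v = x ∨ v = y
  | .fml x _ => v = x

/-- The label `v` does not occur in the sequent `Γ`. -/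
def Fresh {n : ℕ} (v : Label) (Γ : Sequent n) : Prop := ∀ i ∈ Γ, ¬ i.Has v

/-- The item is an equality. -/
def Item.IsEq {n : ℕ} : Item n → Prop
  | .eq _ _ => True
  | _ => False

/-- Replace the label `w` by `u` in a label. -/
def replace (w u x : Label) : Label := if x = w then u else x

/-- Replace all occurrences of the label `w` in an item by `u`. -/
def Item.subst {n : ℕ} (w u : Label) : Item n → Item n
  | .rel α x y => .rel α (replace w u x) (replace w u y)
  | .eq x y => .eq (replace w u x) (replace w u y)
  | .fml x φ => .fml (replace w u x) φ

/-- The parameters of an instance of the rule system for independence of agents: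
two groups, the two labels `w₂`, `w₃` and the eigenvariable `w₄`. -/
structure IOAInst (n : ℕ) : Type where
  A : Finset (Fin n)
  B : Finset (Fin n)
  w₂ : Label
  w₃ : Label
  w₄ : Label

/-- An application of the rule (IOA-U₁) or (IOA-U₂) belonging to an instance of the system. -/
inductive IOAUse (n : ℕ) : Type
  | u₁ (S : IOAInst n) : IOAUse n
  | u₂ (S : IOAInst n) : IOAUse n

/-- `Deriv U Γ`: there is a finite derivation tree with end sequent `Γ` built from the rules of the
labelled calculus, in which `U` is the set of those applications of (IOA-U₁) and (IOA-U₂) that have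
not yet been matched by an application of (IOA-E) below them.

A premise of the form `a ∈ Γ` says that `a` is a principal item of the conclusion `Γ`; it is repeated
in the premise sequents. Where two principal atoms of a rule coincide, one copy in `Γ` is enough:
this is the closure of the calculus under contracted rule instances. -/
inductive Deriv {n : ℕ} : Set (IOAUse n) → Sequent n → Prop
  -- logical rules
  | id (Γ : Sequent n) (w : Label) (p : ℕ) :
      Item.fml w (.var p) ∈ Γ → Item.fml w (.nvar p) ∈ Γ → Deriv ∅ Γ
  | and (U U' : Set (IOAUse n)) (Γ : Sequent n) (w : Label) (φ ψ : Formula n) :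
      Deriv U (.fml w φ ::ₘ Γ) → Deriv U' (.fml w ψ ::ₘ Γ) →
      Deriv (U ∪ U') (.fml w (.and φ ψ) ::ₘ Γ)
  | or (U : Set (IOAUse n)) (Γ : Sequent n) (w : Label) (φ ψ : Formula n) :
      Deriv U (.fml w φ ::ₘ .fml w ψ ::ₘ Γ) → Deriv U (.fml w (.or φ ψ) ::ₘ Γ)
  | nec (U : Set (IOAUse n)) (Γ : Sequent n) (α : Index n) (w v : Label) (φ : Formula n) :
      Fresh v (.fml w (.nec α φ) ::ₘ Γ) →
      Deriv U (.rel α w v ::ₘ .fml v φ ::ₘ Γ) → Deriv U (.fml w (.nec α φ) ::ₘ Γ)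
  | poss (U : Set (IOAUse n)) (Γ : Sequent n) (α : Index n) (w u : Label) (φ : Formula n) :
      Item.rel α w u ∈ Γ → Item.fml w (.poss α φ) ∈ Γ →
      Deriv U (.fml u φ ::ₘ Γ) → Deriv U Γ
  -- rules for equality
  | reflEq (U : Set (IOAUse n)) (Γ : Sequent n) (w : Label) :
      Deriv U (.eq w w ::ₘ Γ) → Deriv U Γ
  | euclEq (U : Set (IOAUse n)) (Γ : Sequent n) (w u v : Label) :
      Item.eq w u ∈ Γ → Item.eq w v ∈ Γ → Deriv U (.eq u v ::ₘ Γ) → Deriv U Γ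
  | subEq (U : Set (IOAUse n)) (Γ Δ : Sequent n) (w u : Label) :
      Item.eq w u ∈ Γ → Δ ≤ Γ → (∀ i ∈ Δ, ¬ i.IsEq) →
      Deriv U (Δ.map (Item.subst w u) + Γ) → Deriv U Γ
  -- rules for settledness and the next state
  | reflBox (U : Set (IOAUse n)) (Γ : Sequent n) (w : Label) :
      Deriv U (.rel .box w w ::ₘ Γ) → Deriv U Γ
  | euclBox (U : Set (IOAUse n)) (Γ : Sequent n) (w u v : Label) :
      Item.rel .box w u ∈ Γ → Item.rel .box w v ∈ Γ →
      Deriv U (.rel .box u v ::ₘ Γ) → Deriv U Γ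
  | serNext (U : Set (IOAUse n)) (Γ : Sequent n) (w v : Label) :
      Fresh v Γ → v ≠ w → Deriv U (.rel .next w v ::ₘ Γ) → Deriv U Γ
  | detNext (U : Set (IOAUse n)) (Γ : Sequent n) (w v u : Label) :
      Item.rel .next w v ∈ Γ → Item.rel .next w u ∈ Γ →
      Deriv U (.eq v u ::ₘ Γ) → Deriv U Γ
  -- rules for groups
  | effEmpty (U : Set (IOAUse n)) (Γ : Sequent n) (w v u : Label) :
      Item.rel .box w v ∈ Γ → Item.rel .next v u ∈ Γ →
      Deriv U (.rel (.stit ∅) w u ::ₘ Γ) → Deriv U Γ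
  | emptyEff (U : Set (IOAUse n)) (Γ : Sequent n) (w v u : Label) :
      Item.rel (.stit ∅) w u ∈ Γ → Fresh v Γ →
      Deriv U (.rel .box w v ::ₘ .rel .next v u ::ₘ Γ) → Deriv U Γ
  | effAg (U : Set (IOAUse n)) (Γ : Sequent n) (w v u : Label) :
      Item.rel .next w v ∈ Γ → Item.rel .box v u ∈ Γ →
      Deriv U (.rel (.stit Finset.univ) w u ::ₘ Γ) → Deriv U Γ
  | agEff (U : Set (IOAUse n)) (Γ : Sequent n) (w v u : Label) :
      Item.rel (.stit Finset.univ) w u ∈ Γ → Fresh v Γ →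
      Deriv U (.rel .next w v ::ₘ .rel .box v u ::ₘ Γ) → Deriv U Γ
  | cMon (U : Set (IOAUse n)) (Γ : Sequent n) (A B : Finset (Fin n)) (w v : Label) :
      B ⊆ A → Item.rel (.stit A) w v ∈ Γ →
      Deriv U (.rel (.stit B) w v ::ₘ Γ) → Deriv U Γ
  -- the system of rules for independence of agents
  | ioaU₁ (U : Set (IOAUse n)) (Γ : Sequent n) (S : IOAInst n) (w₅ : Label) :
      Item.rel (.stit S.A) S.w₄ w₅ ∈ Γ →
      Deriv U (.rel (.stit S.A) S.w₂ w₅ ::ₘ Γ) → Deriv (insert (.u₁ S) U) Γ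
  | ioaU₂ (U : Set (IOAUse n)) (Γ : Sequent n) (S : IOAInst n) (w₆ : Label) :
      Item.rel (.stit S.B) S.w₄ w₆ ∈ Γ →
      Deriv U (.rel (.stit S.B) S.w₃ w₆ ::ₘ Γ) → Deriv (insert (.u₂ S) U) Γ
  | ioaE (U : Set (IOAUse n)) (Γ : Sequent n) (S : IOAInst n) (w₁ : Label) :
      Disjoint S.A S.B →
      Item.rel .box w₁ S.w₂ ∈ Γ → Item.rel .box w₁ S.w₃ ∈ Γ → Fresh S.w₄ Γ →
      (IOAUse.u₁ S ∈ U ↔ IOAUse.u₂ S ∈ U) →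
      Deriv U (.rel .box w₁ S.w₄ ::ₘ Γ) → Deriv (U \ {.u₁ S, .u₂ S}) Γ

/-- Derivability of a sequent: every use of (IOA-U₁) and (IOA-U₂) lies above a matching (IOA-E). -/
def Derivable {n : ℕ} (Γ : Sequent n) : Prop := Deriv ∅ Γ

end Xstit

namespace Xstit

variable {n : ℕ}

/-! ### Countability of the syntax -/

/-! A proof search from an underivable sequent yields a countermodel. Keep a sequent underivable
while applying rules upwards, scheduling every applicable rule fairly. The set `H` of all items ever
met is then closed under the rules and contains no axiom (`exists_saturated`). Labels modulo the
equalities in `H` form a frame, and with `p` true exactly where `nvar p` is listed, every labelled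
formula in `H` is false (`not_sat`). The final sequent `x : φ` lies in `H`, so `φ` is not valid.

Two points need care. The rules for conjunction, disjunction and boxes discard their principal
formula, so sequents do not grow along the search; a stage therefore also records its history, and a
formula that has left the sequent must have been reduced. No structural rules have to be shown
admissible.

The system (IOA) is not local: its U-rules are legal only above a matching (IOA-E), and both or
neither must be used. Underivability is thus taken relative to the set of open instances, and
`DerivableOver.openInst` uses both U-rules once as soon as an instance is opened, which leaves later
uses unrestricted. -/

def Index.toOption : Index n → Option (Option (Finset (Fin n)))
  | .box => none
  | .next => some none
  | .stit A => some (some A)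

instance : Countable (Index n) := by
  refine Function.Injective.countable (f := Index.toOption) ?_
  intro a b h
  cases a <;> cases b <;> simp_all [Index.toOption]

/-- A formula read as a tree with labelled nodes, in Polish notation. -/
def Formula.toList : Formula n → List (ℕ ⊕ Index n × Bool ⊕ Bool ⊕ ℕ)
  | .var p => [.inl p]
  | .nvar p => [.inr (.inr (.inr p))]
  | .and φ ψ => .inr (.inr (.inl true)) :: (φ.toList ++ ψ.toList)
  | .or φ ψ => .inr (.inr (.inl false)) :: (φ.toList ++ ψ.toList)
  | .nec α φ => .inr (.inl (α, true)) :: φ.toList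
  | .poss α φ => .inr (.inl (α, false)) :: φ.toList

/-- Unique readability of Polish notation. The arbitrary tails are what makes the induction go
through: for a binary connective, the second subformula is part of the tail of the first. -/
theorem Formula.toList_append_inj (φ ψ : Formula n) (l m : List _)
    (h : φ.toList ++ l = ψ.toList ++ m) : φ = ψ ∧ l = m := by
  induction φ generalizing ψ l m with
  | and φ₁ φ₂ ih₁ ih₂ =>
    cases ψ <;> simp [Formula.toList] at h
    obtain ⟨rfl, h₁⟩ := ih₁ _ _ _ h
    obtain ⟨rfl, h₂⟩ := ih₂ _ _ _ h₁
    exact ⟨rfl, h₂⟩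
  | or φ₁ φ₂ ih₁ ih₂ =>
    cases ψ <;> simp [Formula.toList] at h
    obtain ⟨rfl, h₁⟩ := ih₁ _ _ _ h
    obtain ⟨rfl, h₂⟩ := ih₂ _ _ _ h₁
    exact ⟨rfl, h₂⟩
  | nec α φ ih =>
    cases ψ <;> simp [Formula.toList] at h
    obtain ⟨rfl, h⟩ := h
    obtain ⟨rfl, h₁⟩ := ih _ _ _ h
    exact ⟨rfl, h₁⟩
  | poss α φ ih =>
    cases ψ <;> simp [Formula.toList] at h
    obtain ⟨rfl, h⟩ := h
    obtain ⟨rfl, h₁⟩ := ih _ _ _ h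
    exact ⟨rfl, h₁⟩
  | _ => cases ψ <;> simp_all [Formula.toList]

instance : Countable (Formula n) := by
  refine Function.Injective.countable (f := Formula.toList) fun φ ψ h => ?_
  exact (Formula.toList_append_inj φ ψ [] [] (by rw [h])).1

def Item.toSum : Item n → (Index n × ℕ × ℕ) ⊕ (ℕ × ℕ) ⊕ (ℕ × Formula n)
  | .rel α x y => .inl (α, x, y)
  | .eq x y => .inr (.inl (x, y))
  | .fml x φ => .inr (.inr (x, φ))

instance : Countable (Item n) := by
  refine Function.Injective.countable (f := Item.toSum) ?_
  intro a b h
  cases a <;> cases b <;> simp_all [Item.toSum]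

/-! ### Fair chains -/

/-- If every triggered task can be done by passing to a larger good state, then there is a chain of
good states along which every task that is triggered from some point on gets done. -/
theorem exists_fair_chain {S T : Type*} [Preorder S] [Countable T] [Nonempty T] (Good : S → Prop)
    (Trig Done : T → S → Prop)
    (step : ∀ τ s, Good s → Trig τ s → ∃ t, s ≤ t ∧ Good t ∧ Done τ t) (s₀ : S) (h₀ : Good s₀) :
    ∃ f : ℕ → S, f 0 = s₀ ∧ Monotone f ∧ (∀ k, Good (f k)) ∧
      ∀ τ k, (∀ m, k ≤ m → Trig τ (f m)) → ∃ m, Done τ (f m) := by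
  classical
  obtain ⟨e, he⟩ := exists_surjective_nat T
  have step' : ∀ (k : ℕ) (s : {s // Good s}), ∃ t : {s // Good s}, s.1 ≤ t.1 ∧
      (Trig (e k.unpair.1) s.1 → Done (e k.unpair.1) t.1) := by
    rintro k ⟨s, hs⟩
    by_cases h : Trig (e k.unpair.1) s
    · obtain ⟨t, hst, ht, hd⟩ := step _ s hs h
      exact ⟨⟨t, ht⟩, hst, fun _ => hd⟩
    · exact ⟨⟨s, hs⟩, le_rfl, fun h' => absurd h' h⟩
  choose next hle hdone using step'
  let f : ℕ → {s // Good s} := fun k => Nat.rec ⟨s₀, h₀⟩ (fun k s => next k s) k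
  refine ⟨fun k => (f k).1, rfl, monotone_nat_of_le_succ fun k => hle k (f k),
    fun k => (f k).2, fun τ k h => ?_⟩
  obtain ⟨a, rfl⟩ := he τ
  -- Each task is attempted infinitely often: step `Nat.pair a k` attempts task `a`, and it comes no
  -- earlier than `k`, so the trigger is in force.
  refine ⟨Nat.pair a k + 1, ?_⟩
  have := hdone (Nat.pair a k) (f (Nat.pair a k))
  rw [Nat.unpair_pair] at this
  exact this (h _ (Nat.right_le_pair a k))

/-! ### Derivability relative to open instances of the rule system -/

/-- The applications of (IOA-U₁) and (IOA-U₂) that belong to an instance in `I`. -/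
def uses (I : Set (IOAInst n)) : Set (IOAUse n) := {a | ∃ S ∈ I, a = .u₁ S ∨ a = .u₂ S}

/-- Derivability of a sequent above applications of (IOA-E) for the instances in `I`. -/
def DerivableOver (I : Set (IOAInst n)) (Γ : Sequent n) : Prop := ∃ U ⊆ uses I, Deriv U Γ

theorem exists_fresh (Γ : Sequent n) (F : Finset ℕ) : ∃ v, Fresh v Γ ∧ v ∉ F := by
  classical
  have key : ∃ G : Finset ℕ, ∀ v ∉ G, Fresh v Γ := by
    induction Γ using Multiset.induction_on with
    | empty => exact ⟨∅, fun v _ i hi => by simp at hi⟩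
    | cons a Γ ih =>
      obtain ⟨G, hG⟩ := ih
      have ha : ∃ x y, ∀ v, a.Has v → v = x ∨ v = y := by
        cases a with
        | rel α x y => exact ⟨x, y, fun v h => h⟩
        | eq x y => exact ⟨x, y, fun v h => h⟩
        | fml x φ => exact ⟨x, x, fun v h => Or.inl h⟩
      obtain ⟨x, y, hxy⟩ := ha
      refine ⟨insert x (insert y G), fun v hv i hi hh => ?_⟩
      simp only [Finset.mem_insert, not_or] at hv
      rcases Multiset.mem_cons.1 hi with rfl | hi
      · rcases hxy v hh with h | h
        · exact hv.1 h
        · exact hv.2.1 h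
      · exact hG v hv.2.2 i hi hh
  obtain ⟨G, hG⟩ := key
  obtain ⟨v, hv⟩ := Infinite.exists_notMem_finset (G ∪ F)
  simp only [Finset.mem_union, not_or] at hv
  exact ⟨v, hG v hv.1, hv.2⟩

/-- An application of (IOA-E) with eigenvariable `w₄`, followed by one application of (IOA-U₁) and one
of (IOA-U₂) to a successor `v` of `w₄`. -/
theorem DerivableOver.openInst {I : Set (IOAInst n)} {Γ : Sequent n} {S : IOAInst n} {w₁ v : Label}
    (hS : Disjoint S.A S.B) (h₂ : Item.rel .box w₁ S.w₂ ∈ Γ) (h₃ : Item.rel .box w₁ S.w₃ ∈ Γ)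
    (h₄ : Fresh S.w₄ Γ) (hv : Fresh v (.rel .box w₁ S.w₄ ::ₘ Γ)) (hv₄ : v ≠ S.w₄)
    (h : DerivableOver (insert S I)
      (.rel (.stit S.B) S.w₃ v ::ₘ .rel (.stit S.B) S.w₄ v ::ₘ .rel (.stit S.A) S.w₂ v ::ₘ
        .rel (.stit S.A) S.w₄ v ::ₘ .rel (.stit Finset.univ) S.w₄ v ::ₘ .rel .box v v ::ₘ
        .rel .next S.w₄ v ::ₘ .rel .box w₁ S.w₄ ::ₘ Γ)) : DerivableOver I Γ := by
  obtain ⟨U, hU, d⟩ := h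
  -- These steps build the derivation downwards. The label `v` becomes a successor of `w₄` for the
  -- grand coalition, hence by monotonicity for both groups, so each U-rule has something to act on.
  -- With both uses recorded, the both-or-neither condition of (IOA-E) holds whatever `U` contains.
  have d := Deriv.ioaU₂ _ _ S v (by simp) d
  have d := Deriv.cMon _ _ Finset.univ _ S.w₄ v (Finset.subset_univ _) (by simp) d
  have d := Deriv.ioaU₁ _ _ S v (by simp) d
  have d := Deriv.cMon _ _ Finset.univ _ S.w₄ v (Finset.subset_univ _) (by simp) d
  have d := Deriv.effAg _ _ S.w₄ v v (by simp) (by simp) d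
  have d := Deriv.reflBox _ _ v d
  have d := Deriv.serNext _ _ S.w₄ v hv hv₄ d
  refine ⟨_, ?_, Deriv.ioaE _ _ S w₁ hS h₂ h₃ h₄ (by simp) d⟩
  rintro a ⟨ha, hna⟩
  simp only [Set.mem_insert_iff, Set.mem_singleton_iff, not_or] at ha hna
  rcases ha with ha | ha | ha
  · exact absurd ha hna.1
  · exact absurd ha hna.2
  · obtain ⟨S', hS', h'⟩ := hU ha
    rcases hS' with rfl | hS'
    · rcases h' with h' | h'
      · exact absurd h' hna.1
      · exact absurd h' hna.2
    · exact ⟨S', hS', h'⟩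

/-! ### Stages of the proof search -/

/-- A stage of the proof search: the current sequent, the instances of the rule system that have been
opened, and all items that have occurred so far. -/
structure Stage (n : ℕ) : Type where
  seq : Sequent n
  insts : Set (IOAInst n)
  items : Set (Item n)

/-- The current sequent is left out of the order because consumed formulae disappear from it. -/
instance : Preorder (Stage n) where
  le s t := s.insts ⊆ t.insts ∧ s.items ⊆ t.items
  le_refl _ := ⟨subset_rfl, subset_rfl⟩
  le_trans _ _ _ h h' := ⟨h.1.trans h'.1, h.2.trans h'.2⟩

/-- The item is a conjunction, disjunction or box formula whose rule has been applied. -/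
def Reduced (H : Set (Item n)) : Item n → Prop
  | .fml w (.and φ ψ) => .fml w φ ∈ H ∨ .fml w ψ ∈ H
  | .fml w (.or φ ψ) => .fml w φ ∈ H ∧ .fml w ψ ∈ H
  | .fml w (.nec α φ) => ∃ v, .rel α w v ∈ H ∧ .fml v φ ∈ H
  | _ => False

theorem Reduced.mono {H K : Set (Item n)} (h : H ⊆ K) {i : Item n} (hi : Reduced H i) :
    Reduced K i := by
  rcases i with _ | _ | ⟨w, _ | _ | _ | _ | _ | _⟩ <;> simp only [Reduced] at hi ⊢
  · exact hi.imp (@h _) (@h _)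
  · exact hi.imp (@h _) (@h _)
  · obtain ⟨v, h₁, h₂⟩ := hi
    exact ⟨v, h h₁, h h₂⟩

/-- The rule for the item removes it from the sequent. -/
def Item.Consumable : Item n → Prop
  | .fml _ (.and _ _) => True
  | .fml _ (.or _ _) => True
  | .fml _ (.nec _ _) => True
  | _ => False

theorem Reduced.consumable {H : Set (Item n)} {i : Item n} (hi : Reduced H i) : i.Consumable := by
  rcases i with _ | _ | ⟨w, _ | _ | _ | _ | _ | _⟩ <;> simp_all [Reduced, Item.Consumable]

/-- The field `kept` makes up for the loss of principal formulae: relational atoms, equalities,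
literals and diamonds can never be reduced, so they remain in the sequent for good. -/
structure Stage.Good (s : Stage n) : Prop where
  underivable : ¬ DerivableOver s.insts s.seq
  sub : ∀ i ∈ s.seq, i ∈ s.items
  kept : ∀ i ∈ s.items, i ∈ s.seq ∨ Reduced s.items i

theorem Stage.Good.mem_seq {s : Stage n} (hs : s.Good) {i : Item n} (hi : i ∈ s.items)
    (hc : ¬ i.Consumable) : i ∈ s.seq :=
  (hs.kept i hi).resolve_right fun h => hc h.consumable

/-- Adding items to the sequent of a good stage. -/
theorem Stage.Good.add {s : Stage n} (hs : s.Good) (J : Set (IOAInst n)) (hJ : s.insts ⊆ J)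
    (L : Sequent n) (h : DerivableOver J (L + s.seq) → DerivableOver s.insts s.seq) :
    ∃ t, s ≤ t ∧ t.Good ∧ t.insts = J ∧ ∀ i ∈ L, i ∈ t.items := by
  refine ⟨⟨L + s.seq, J, s.items ∪ {i | i ∈ L}⟩, ⟨hJ, Set.subset_union_left⟩,
    ⟨fun h' => hs.underivable (h h'), fun i hi => ?_, fun i hi => ?_⟩, rfl, fun i hi => Or.inr hi⟩
  · exact (Multiset.mem_add.1 hi).elim Or.inr fun h => Or.inl (hs.sub i h)
  · rcases hi with hi | hi
    · exact (hs.kept i hi).imp (fun h => Multiset.mem_add.2 (Or.inr h))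
        (Reduced.mono Set.subset_union_left)
    · exact Or.inl (Multiset.mem_add.2 (Or.inl hi))

/-- Replacing a formula by items that reduce it. -/
theorem Stage.Good.replace {s : Stage n} (hs : s.Good) {i : Item n} {Γ : Sequent n}
    (hi : s.seq = i ::ₘ Γ) (L : Sequent n) (h : ¬ DerivableOver s.insts (L + Γ))
    (hr : Reduced {j | j ∈ L} i) : ∃ t, s ≤ t ∧ t.Good ∧ Reduced t.items i := by
  refine ⟨⟨L + Γ, s.insts, s.items ∪ {i | i ∈ L}⟩, ⟨subset_rfl, Set.subset_union_left⟩,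
    ⟨h, fun j hj => ?_, fun j hj => ?_⟩, hr.mono Set.subset_union_right⟩
  · refine (Multiset.mem_add.1 hj).elim Or.inr fun h => Or.inl (hs.sub j ?_)
    rw [hi]
    exact Multiset.mem_cons_of_mem h
  · rcases hj with hj | hj
    · rcases hs.kept j hj with hj | hj
      · rw [hi] at hj
        rcases Multiset.mem_cons.1 hj with rfl | hj
        · exact Or.inr (hr.mono Set.subset_union_right)
        · exact Or.inl (Multiset.mem_add.2 (Or.inr hj))
      · exact Or.inr (hj.mono Set.subset_union_left)
    · exact Or.inl (Multiset.mem_add.2 (Or.inl hj))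

theorem Stage.Good.reduce {s : Stage n} (hs : s.Good) {i : Item n} (hi : i ∈ s.items)
    (hc : i.Consumable) : ∃ t, s ≤ t ∧ t.Good ∧ Reduced t.items i := by
  rcases hs.kept i hi with hmem | hr
  swap
  · exact ⟨s, le_rfl, hs, hr⟩
  obtain ⟨Γ, hΓ⟩ := Multiset.exists_cons_of_mem hmem
  have hu := hs.underivable
  rw [hΓ] at hu
  rcases i with _ | _ | ⟨w, _ | _ | ⟨φ, ψ⟩ | ⟨φ, ψ⟩ | ⟨α, φ⟩ | _⟩ <;>
    simp only [Item.Consumable] at hc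
  -- If both premises were derivable, so would be the conclusion; the search follows an underivable
  -- one.
  · by_cases h₁ : DerivableOver s.insts (.fml w φ ::ₘ Γ)
    · by_cases h₂ : DerivableOver s.insts (.fml w ψ ::ₘ Γ)
      · obtain ⟨U, hU, d⟩ := h₁
        obtain ⟨U', hU', d'⟩ := h₂
        exact absurd ⟨_, Set.union_subset hU hU', .and _ _ _ _ _ _ d d'⟩ hu
      · exact hs.replace hΓ {.fml w ψ} (by simpa using h₂) (by simp [Reduced])
    · exact hs.replace hΓ {.fml w φ} (by simpa using h₁) (by simp [Reduced])
  · refine hs.replace hΓ (.fml w φ ::ₘ {.fml w ψ}) ?_ (by simp [Reduced])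
    rintro ⟨U, hU, d⟩
    exact hu ⟨U, hU, .or _ _ _ _ _ (by simpa using d)⟩
  · obtain ⟨v, hv, -⟩ := exists_fresh (.fml w (.nec α φ) ::ₘ Γ) ∅
    refine hs.replace hΓ (.rel α w v ::ₘ {.fml v φ}) ?_ ⟨v, by simp, by simp⟩
    rintro ⟨U, hU, d⟩
    exact hu ⟨U, hU, .nec _ _ _ _ v _ hv (by simpa using d)⟩

/-! ### Tasks of the proof search -/

/-- Above the instances in `I`, the item `j` may be added to every sequent that contains `L`. -/
def Closes (I : Set (IOAInst n)) (L : List (Item n)) (j : Item n) : Prop :=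
  ∀ J, I ⊆ J → ∀ Γ : Sequent n, (∀ i ∈ L, i ∈ Γ) → DerivableOver J (j ::ₘ Γ) → DerivableOver J Γ

theorem closes_of_rule {I : Set (IOAInst n)} {L : List (Item n)} {j : Item n}
    (h : ∀ (U : Set (IOAUse n)) (Γ : Sequent n), (∀ i ∈ L, i ∈ Γ) → Deriv U (j ::ₘ Γ) → Deriv U Γ) :
    Closes I L j :=
  fun _ _ Γ hL ⟨U, hU, d⟩ => ⟨U, hU, h U Γ hL d⟩

inductive Task (n : ℕ) : Type
  | close (L : List (Item n)) (j : Item n) : Task n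
  | reduce (i : Item n) : Task n
  | serNext (w : Label) : Task n
  | emptyEff (w u : Label) : Task n
  | agEff (w u : Label) : Task n
  | indep (A B : Finset (Fin n)) (w₁ w₂ w₃ : Label) : Task n

def Task.toSum : Task n → (List (Item n) × Item n) ⊕ Item n ⊕ ℕ ⊕ (ℕ × ℕ) ⊕ (ℕ × ℕ) ⊕
    (Finset (Fin n) × Finset (Fin n) × ℕ × ℕ × ℕ)
  | .close L j => .inl (L, j)
  | .reduce i => .inr (.inl i)
  | .serNext w => .inr (.inr (.inl w))
  | .emptyEff w u => .inr (.inr (.inr (.inl (w, u))))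
  | .agEff w u => .inr (.inr (.inr (.inr (.inl (w, u)))))
  | .indep A B w₁ w₂ w₃ => .inr (.inr (.inr (.inr (.inr (A, B, w₁, w₂, w₃)))))

instance : Countable (Task n) := by
  refine Function.Injective.countable (f := Task.toSum) ?_
  intro a b h
  cases a <;> cases b <;> simp_all [Task.toSum]

instance : Nonempty (Task n) := ⟨.serNext 0⟩

def Task.Triggered : Task n → Stage n → Prop
  | .close L j, s => (∀ i ∈ L, i ∈ s.items ∧ ¬ i.Consumable) ∧ Closes s.insts L j
  | .reduce i, s => i ∈ s.items ∧ i.Consumable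
  | .serNext _, _ => True
  | .emptyEff w u, s => .rel (.stit ∅) w u ∈ s.items
  | .agEff w u, s => .rel (.stit Finset.univ) w u ∈ s.items
  | .indep A B w₁ w₂ w₃, s => Disjoint A B ∧ .rel .box w₁ w₂ ∈ s.items ∧ .rel .box w₁ w₃ ∈ s.items

def Task.Done : Task n → Stage n → Prop
  | .close _ j, s => j ∈ s.items
  | .reduce i, s => Reduced s.items i
  | .serNext w, s => ∃ v, .rel .next w v ∈ s.items
  | .emptyEff w u, s => ∃ v, .rel .box w v ∈ s.items ∧ .rel .next v u ∈ s.items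
  | .agEff w u, s => ∃ v, .rel .next w v ∈ s.items ∧ .rel .box v u ∈ s.items
  | .indep A B w₁ w₂ w₃, s => ∃ w₄, .rel .box w₁ w₄ ∈ s.items ∧ ⟨A, B, w₂, w₃, w₄⟩ ∈ s.insts

/-- Triggers persist, so fairness applies to them. For `close` this is why `Closes` quantifies over
all larger sets of open instances. -/
theorem Task.Triggered.mono {τ : Task n} {s t : Stage n} (h : s ≤ t) (hτ : τ.Triggered s) :
    τ.Triggered t := by
  cases τ with
  | close L j =>
    exact ⟨fun i hi => ⟨h.2 (hτ.1 i hi).1, (hτ.1 i hi).2⟩, fun J hJ => hτ.2 J (h.1.trans hJ)⟩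
  | reduce i => exact ⟨h.2 hτ.1, hτ.2⟩
  | serNext w => trivial
  | emptyEff w u => exact h.2 hτ
  | agEff w u => exact h.2 hτ
  | indep A B w₁ w₂ w₃ => exact ⟨hτ.1, h.2 hτ.2.1, h.2 hτ.2.2⟩

theorem Task.exists_done (τ : Task n) (s : Stage n) (hs : s.Good) (hτ : τ.Triggered s) :
    ∃ t, s ≤ t ∧ t.Good ∧ τ.Done t := by
  cases τ with
  | close L j =>
    obtain ⟨t, hst, ht, -, hL⟩ := hs.add s.insts subset_rfl {j} fun h =>
      hτ.2 _ subset_rfl s.seq (fun i hi => hs.mem_seq (hτ.1 i hi).1 (hτ.1 i hi).2) (by simpa using h)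
    exact ⟨t, hst, ht, hL j (by simp)⟩
  | reduce i => exact hs.reduce hτ.1 hτ.2
  | serNext w =>
    -- The label `w` need not occur in the sequent, so freshness alone would not give `v ≠ w`.
    obtain ⟨v, hv, hvw⟩ := exists_fresh s.seq {w}
    obtain ⟨t, hst, ht, -, hL⟩ := hs.add s.insts subset_rfl {.rel .next w v} fun ⟨U, hU, d⟩ =>
      ⟨U, hU, .serNext _ _ w v hv (by simpa using hvw) (by simpa using d)⟩
    exact ⟨t, hst, ht, v, hL _ (by simp)⟩
  | emptyEff w u =>
    obtain ⟨v, hv, -⟩ := exists_fresh s.seq ∅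
    obtain ⟨t, hst, ht, -, hL⟩ := hs.add s.insts subset_rfl (.rel .box w v ::ₘ {.rel .next v u})
      fun ⟨U, hU, d⟩ =>
        ⟨U, hU, .emptyEff _ _ w v u (hs.mem_seq hτ (by simp [Item.Consumable])) hv (by simpa using d)⟩
    exact ⟨t, hst, ht, v, hL _ (by simp), hL _ (by simp)⟩
  | agEff w u =>
    obtain ⟨v, hv, -⟩ := exists_fresh s.seq ∅
    obtain ⟨t, hst, ht, -, hL⟩ := hs.add s.insts subset_rfl (.rel .next w v ::ₘ {.rel .box v u})
      fun ⟨U, hU, d⟩ =>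
        ⟨U, hU, .agEff _ _ w v u (hs.mem_seq hτ (by simp [Item.Consumable])) hv (by simpa using d)⟩
    exact ⟨t, hst, ht, v, hL _ (by simp), hL _ (by simp)⟩
  | indep A B w₁ w₂ w₃ =>
    obtain ⟨hAB, h₂, h₃⟩ := hτ
    obtain ⟨w₄, h₄, -⟩ := exists_fresh s.seq ∅
    obtain ⟨v, hv, hv₄⟩ := exists_fresh (.rel .box w₁ w₄ ::ₘ s.seq) {w₄}
    obtain ⟨t, hst, ht, hI, hL⟩ := hs.add (insert ⟨A, B, w₂, w₃, w₄⟩ s.insts) (Set.subset_insert _ _)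
      (.rel (.stit B) w₃ v ::ₘ .rel (.stit B) w₄ v ::ₘ .rel (.stit A) w₂ v ::ₘ
        .rel (.stit A) w₄ v ::ₘ .rel (.stit Finset.univ) w₄ v ::ₘ .rel .box v v ::ₘ
        .rel .next w₄ v ::ₘ {.rel .box w₁ w₄}) fun h =>
      DerivableOver.openInst (S := ⟨A, B, w₂, w₃, w₄⟩) (w₁ := w₁) (v := v) hAB
        (hs.mem_seq h₂ (by simp [Item.Consumable])) (hs.mem_seq h₃ (by simp [Item.Consumable]))
        h₄ hv (by simpa using hv₄) (by simpa using h)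
    exact ⟨t, hst, ht, w₄, hL _ (by simp), by simp [hI]⟩

/-! ### Saturated sets of items -/

/-- A set of items that is closed under the rules of the calculus and contains no axiom. -/
structure Saturated (H : Set (Item n)) : Prop where
  not_axiom : ∀ w p, .fml w (.var p) ∈ H → .fml w (.nvar p) ∉ H
  reduced : ∀ i ∈ H, i.Consumable → Reduced H i
  poss : ∀ α w u φ, .rel α w u ∈ H → .fml w (.poss α φ) ∈ H → .fml u φ ∈ H
  reflEq : ∀ w, .eq w w ∈ H
  euclEq : ∀ w u v, .eq w u ∈ H → .eq w v ∈ H → .eq u v ∈ H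
  subRel : ∀ w u α x y, .eq w u ∈ H → .rel α x y ∈ H → .rel α (replace w u x) (replace w u y) ∈ H
  subVar : ∀ w u p, .eq w u ∈ H → .fml w (.var p) ∈ H → .fml u (.var p) ∈ H
  reflBox : ∀ w, .rel .box w w ∈ H
  euclBox : ∀ w u v, .rel .box w u ∈ H → .rel .box w v ∈ H → .rel .box u v ∈ H
  serNext : ∀ w, ∃ v, .rel .next w v ∈ H
  detNext : ∀ w v u, .rel .next w v ∈ H → .rel .next w u ∈ H → .eq v u ∈ H
  effEmpty : ∀ w v u, .rel .box w v ∈ H → .rel .next v u ∈ H → .rel (.stit ∅) w u ∈ H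
  emptyEff : ∀ w u, .rel (.stit ∅) w u ∈ H → ∃ v, .rel .box w v ∈ H ∧ .rel .next v u ∈ H
  effAg : ∀ w v u, .rel .next w v ∈ H → .rel .box v u ∈ H → .rel (.stit Finset.univ) w u ∈ H
  agEff : ∀ w u, .rel (.stit Finset.univ) w u ∈ H → ∃ v, .rel .next w v ∈ H ∧ .rel .box v u ∈ H
  cMon : ∀ A B : Finset (Fin n), B ⊆ A → ∀ w v, .rel (.stit A) w v ∈ H → .rel (.stit B) w v ∈ H
  indep : ∀ A B : Finset (Fin n), Disjoint A B → ∀ w₁ w₂ w₃, .rel .box w₁ w₂ ∈ H →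
    .rel .box w₁ w₃ ∈ H → ∃ w₄, .rel .box w₁ w₄ ∈ H ∧
      (∀ w₅, .rel (.stit A) w₄ w₅ ∈ H → .rel (.stit A) w₂ w₅ ∈ H) ∧
      (∀ w₆, .rel (.stit B) w₄ w₆ ∈ H → .rel (.stit B) w₃ w₆ ∈ H)

theorem exists_saturated (x : Label) (φ : Formula n)
    (h : ¬ Derivable ({.fml x φ} : Sequent n)) : ∃ H : Set (Item n), .fml x φ ∈ H ∧ Saturated H := by
  obtain ⟨f, hf₀, hmono, hgood, hfair⟩ := exists_fair_chain Stage.Good Task.Triggered Task.Done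
    Task.exists_done ⟨{.fml x φ}, ∅, {.fml x φ}⟩
    ⟨by
      rintro ⟨U, hU, d⟩
      -- With no instance open, no pending use is allowed, so relative derivability is plain
      -- derivability.
      obtain rfl : U = ∅ := Set.eq_empty_of_forall_notMem fun a ha => by
        obtain ⟨S, hS, -⟩ := hU ha
        exact hS
      exact h d, fun i hi => by simpa using hi, fun i hi => Or.inl (by simpa using hi)⟩
  have hdone : ∀ τ k, Task.Triggered τ (f k) → ∃ m, Task.Done τ (f m) := fun τ k hτ =>
    hfair τ k fun m hm => hτ.mono (hmono hm)
  let H : Set (Item n) := ⋃ k, (f k).items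
  have up : ∀ {i : Item n} {k m}, k ≤ m → i ∈ (f k).items → i ∈ (f m).items :=
    fun hkm hi => (hmono hkm).2 hi
  have toH : ∀ {i : Item n} {k}, i ∈ (f k).items → i ∈ H := fun hi => Set.mem_iUnion_of_mem _ hi
  have ofH : ∀ {i : Item n}, i ∈ H → ∃ k, i ∈ (f k).items := fun hi => Set.mem_iUnion.1 hi
  have ofH₂ : ∀ {i j : Item n}, i ∈ H → j ∈ H → ∃ k, i ∈ (f k).items ∧ j ∈ (f k).items := by
    intro i j hi hj
    obtain ⟨k, hk⟩ := ofH hi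
    obtain ⟨m, hm⟩ := ofH hj
    exact ⟨max k m, up (le_max_left _ _) hk, up (le_max_right _ _) hm⟩
  have close : ∀ (k : ℕ) (L : List (Item n)) (j : Item n),
      (∀ i ∈ L, i ∈ (f k).items ∧ ¬ i.Consumable) → Closes (f k).insts L j → j ∈ H :=
    fun k L j hL hc => by
      obtain ⟨m, hm⟩ := hdone (.close L j) k ⟨hL, hc⟩
      exact toH hm
  have close₀ : ∀ j : Item n, (∀ U Γ, Deriv U (j ::ₘ Γ) → Deriv U Γ) → j ∈ H := fun j hr =>
    close 0 [] j (by simp) (closes_of_rule fun U Γ _ => hr U Γ)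
  have close₁ : ∀ i j : Item n, i ∈ H → ¬ i.Consumable →
      (∀ U Γ, i ∈ Γ → Deriv U (j ::ₘ Γ) → Deriv U Γ) → j ∈ H := fun i j hi hi' hr => by
    obtain ⟨k, hk⟩ := ofH hi
    exact close k [i] j (by simp [hk, hi']) (closes_of_rule fun U Γ hL => hr U Γ (hL i (by simp)))
  have close₂ : ∀ i i' j : Item n, i ∈ H → i' ∈ H → ¬ i.Consumable → ¬ i'.Consumable →
      (∀ U Γ, i ∈ Γ → i' ∈ Γ → Deriv U (j ::ₘ Γ) → Deriv U Γ) → j ∈ H :=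
    fun i i' j hi hi' hc hc' hr => by
      obtain ⟨k, hk, hk'⟩ := ofH₂ hi hi'
      exact close k [i, i'] j (by simp [hk, hk', hc, hc'])
        (closes_of_rule fun U Γ hL => hr U Γ (hL i (by simp)) (hL i' (by simp)))
  have sub : ∀ w u (i : Item n), .eq w u ∈ H → i ∈ H → ¬ i.Consumable → ¬ i.IsEq →
      i.subst w u ∈ H := fun w u i he hi hc hE =>
    -- Here and below, `id` proves that an item is not consumable, since the predicate unfolds to
    -- `False`.
    close₂ _ _ _ he hi id hc fun U Γ h₁ h₂ d => .subEq U Γ {i} w u h₁ (by simpa using h₂)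
      (by simpa using hE) (by simpa using d)
  refine ⟨H, toH (k := 0) (by simp [hf₀]), ?_⟩
  constructor
  · intro w p h₁ h₂
    obtain ⟨k, hk₁, hk₂⟩ := ofH₂ h₁ h₂
    exact (hgood k).underivable ⟨∅, Set.empty_subset _,
      .id _ w p ((hgood k).mem_seq hk₁ id) ((hgood k).mem_seq hk₂ id)⟩
  · intro i hi hc
    obtain ⟨k, hk⟩ := ofH hi
    obtain ⟨m, hm⟩ := hdone (.reduce i) k ⟨hk, hc⟩
    exact Reduced.mono (fun _ h => toH h) hm
  · exact fun α w u φ h₁ h₂ =>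
      close₂ _ _ _ h₁ h₂ id id fun U Γ h₁ h₂ => .poss U Γ α w u φ h₁ h₂
  · exact fun w => close₀ _ fun U Γ => .reflEq U Γ w
  · exact fun w u v h₁ h₂ => close₂ _ _ _ h₁ h₂ id id fun U Γ h₁ h₂ => .euclEq U Γ w u v h₁ h₂
  · exact fun w u α x y h₁ h₂ => sub w u _ h₁ h₂ id id
  · intro w u p h₁ h₂
    simpa [Item.subst, replace] using sub w u _ h₁ h₂ id id
  · exact fun w => close₀ _ fun U Γ => .reflBox U Γ w
  · exact fun w u v h₁ h₂ => close₂ _ _ _ h₁ h₂ id id fun U Γ h₁ h₂ => .euclBox U Γ w u v h₁ h₂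
  · intro w
    obtain ⟨m, v, hv⟩ := hdone (.serNext w) 0 trivial
    exact ⟨v, toH hv⟩
  · exact fun w v u h₁ h₂ => close₂ _ _ _ h₁ h₂ id id fun U Γ h₁ h₂ => .detNext U Γ w v u h₁ h₂
  · exact fun w v u h₁ h₂ => close₂ _ _ _ h₁ h₂ id id fun U Γ h₁ h₂ => .effEmpty U Γ w v u h₁ h₂
  · intro w u h₁
    obtain ⟨k, hk⟩ := ofH h₁
    obtain ⟨m, v, hv, hv'⟩ := hdone (.emptyEff w u) k hk
    exact ⟨v, toH hv, toH hv'⟩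
  · exact fun w v u h₁ h₂ => close₂ _ _ _ h₁ h₂ id id fun U Γ h₁ h₂ => .effAg U Γ w v u h₁ h₂
  · intro w u h₁
    obtain ⟨k, hk⟩ := ofH h₁
    obtain ⟨m, v, hv, hv'⟩ := hdone (.agEff w u) k hk
    exact ⟨v, toH hv, toH hv'⟩
  · exact fun A B hBA w v h₁ => close₁ _ _ h₁ id fun U Γ h₁ => .cMon U Γ A B w v hBA h₁
  · intro A B hAB w₁ w₂ w₃ h₂ h₃
    obtain ⟨k, hk₂, hk₃⟩ := ofH₂ h₂ h₃
    obtain ⟨m, w₄, h₄, hS⟩ := hdone (.indep A B w₁ w₂ w₃) k ⟨hAB, hk₂, hk₃⟩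
    refine ⟨w₄, toH h₄, fun w₅ h₅ => ?_, fun w₆ h₆ => ?_⟩
    · obtain ⟨k', hk'⟩ := ofH h₅
      -- By stage `max m k'` the instance is open and the atom has appeared, however late, so the
      -- U-rule may be applied.
      refine close (max m k') [.rel (.stit A) w₄ w₅] _
        (by simp [up (le_max_right m k') hk', Item.Consumable]) ?_
      rintro J hJ Γ hL ⟨U, hU, d⟩
      exact ⟨_, Set.insert_subset ⟨_, hJ ((hmono (le_max_left m k')).1 hS), Or.inl rfl⟩ hU,
        .ioaU₁ U Γ ⟨A, B, w₂, w₃, w₄⟩ w₅ (hL _ (by simp)) d⟩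
    · obtain ⟨k', hk'⟩ := ofH h₆
      refine close (max m k') [.rel (.stit B) w₄ w₆] _
        (by simp [up (le_max_right m k') hk', Item.Consumable]) ?_
      rintro J hJ Γ hL ⟨U, hU, d⟩
      exact ⟨_, Set.insert_subset ⟨_, hJ ((hmono (le_max_left m k')).1 hS), Or.inr rfl⟩ hU,
        .ioaU₂ U Γ ⟨A, B, w₂, w₃, w₄⟩ w₆ (hL _ (by simp)) d⟩

/-! ### The model of a saturated set -/

namespace Saturated

variable {H : Set (Item n)} (hH : Saturated H)

include hH

theorem symmEq {w u : Label} (h : .eq w u ∈ H) : .eq u w ∈ H :=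
  hH.euclEq w u w h (hH.reflEq w)

theorem transEq {w u v : Label} (h : .eq w u ∈ H) (h' : .eq u v ∈ H) : .eq w v ∈ H :=
  hH.euclEq u w v (hH.symmEq h) h'

theorem eq_replace {w u : Label} (h : .eq w u ∈ H) (x : Label) : .eq x (replace w u x) ∈ H := by
  unfold replace
  split_ifs with hx
  · exact hx ▸ h
  · exact hH.reflEq x

/-- Substitution replaces every occurrence of `w`, so when `u` is `w` the target changes too; it is
therefore controlled only up to equality. -/
theorem rel_left {α : Index n} {w w' u : Label} (h : .eq w w' ∈ H) (hr : .rel α w u ∈ H) :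
    ∃ u', .eq u u' ∈ H ∧ .rel α w' u' ∈ H := by
  refine ⟨replace w w' u, hH.eq_replace h u, ?_⟩
  simpa [replace] using hH.subRel w w' α w u h hr

/-- Labels modulo the equalities in `H`. -/
def setoid : Setoid Label where
  r w u := .eq w u ∈ H
  iseqv := ⟨hH.reflEq, hH.symmEq, hH.transEq⟩

/-- The accessibility relations on classes of labels. -/
def accessible (α : Index n) (a b : Quotient hH.setoid) : Prop :=
  ∃ w u, Quotient.mk hH.setoid w = a ∧ Quotient.mk hH.setoid u = b ∧ .rel α w u ∈ H

theorem mk_eq {w u : Label} : Quotient.mk hH.setoid w = Quotient.mk hH.setoid u ↔ .eq w u ∈ H :=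
  Quotient.eq

/-- The source representative can be prescribed. This lets consecutive edges be composed at the
level of labels, so each frame condition reduces to the matching closure property of `H`. -/
theorem accessible_mk_iff {α : Index n} {w : Label} {b : Quotient hH.setoid} :
    hH.accessible α (Quotient.mk _ w) b ↔ ∃ u, Quotient.mk _ u = b ∧ .rel α w u ∈ H := by
  constructor
  · rintro ⟨w', u, hw, rfl, hr⟩
    obtain ⟨u', hu, hr'⟩ := hH.rel_left (hH.mk_eq.1 hw) hr
    exact ⟨u', (hH.mk_eq.2 hu).symm, hr'⟩
  · rintro ⟨u, rfl, hr⟩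
    exact ⟨w, u, rfl, rfl, hr⟩

theorem accessible_of_rel {α : Index n} {w u : Label} (h : .rel α w u ∈ H) :
    hH.accessible α (Quotient.mk _ w) (Quotient.mk _ u) :=
  ⟨w, u, rfl, rfl, h⟩

theorem box_symm {w u : Label} (h : .rel .box w u ∈ H) : .rel .box u w ∈ H :=
  hH.euclBox w u w h (hH.reflBox w)

def frame : Frame n (Quotient hH.setoid) where
  R := hH.accessible
  nonempty := ⟨Quotient.mk _ 0⟩
  box_equiv := by
    refine ⟨fun a => ?_, ?_, ?_⟩
    · induction a using Quotient.inductionOn with | _ w =>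
      exact hH.accessible_of_rel (hH.reflBox w)
    · rintro _ _ ⟨w, u, rfl, rfl, h⟩
      exact hH.accessible_of_rel (hH.box_symm h)
    · rintro _ _ c ⟨w, u, rfl, rfl, h⟩ h'
      obtain ⟨v, rfl, k⟩ := hH.accessible_mk_iff.1 h'
      exact hH.accessible_of_rel (hH.euclBox u w v (hH.box_symm h) k)
  next_serial a := by
    induction a using Quotient.inductionOn with | _ w =>
    obtain ⟨v, hv⟩ := hH.serNext w
    exact ⟨_, hH.accessible_of_rel hv⟩
  next_det := by
    rintro _ _ c ⟨w, u, rfl, rfl, h⟩ h'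
    obtain ⟨v, rfl, k⟩ := hH.accessible_mk_iff.1 h'
    exact hH.mk_eq.2 (hH.detNext w u v h k)
  empty_iff a b := by
    constructor
    · rintro ⟨w, u, rfl, rfl, h⟩
      obtain ⟨v, h₁, h₂⟩ := hH.emptyEff w u h
      exact ⟨_, hH.accessible_of_rel h₁, hH.accessible_of_rel h₂⟩
    · rintro ⟨_, ⟨w, v, rfl, rfl, h⟩, h'⟩
      obtain ⟨u, rfl, k⟩ := hH.accessible_mk_iff.1 h'
      exact hH.accessible_of_rel (hH.effEmpty w v u h k)
  grand_iff a b := by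
    constructor
    · rintro ⟨w, u, rfl, rfl, h⟩
      obtain ⟨v, h₁, h₂⟩ := hH.agEff w u h
      exact ⟨_, hH.accessible_of_rel h₁, hH.accessible_of_rel h₂⟩
    · rintro ⟨_, ⟨w, v, rfl, rfl, h⟩, h'⟩
      obtain ⟨u, rfl, k⟩ := hH.accessible_mk_iff.1 h'
      exact hH.accessible_of_rel (hH.effAg w v u h k)
  mono := by
    rintro A B hBA _ _ ⟨w, u, rfl, rfl, h⟩
    exact hH.accessible_of_rel (hH.cMon A B hBA w u h)
  indep := by
    rintro A B hAB _ _ c ⟨w₁, w₂, rfl, rfl, h⟩ h'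
    obtain ⟨w₃, rfl, k⟩ := hH.accessible_mk_iff.1 h'
    obtain ⟨w₄, h₄, hA, hB⟩ := hH.indep A B hAB w₁ w₂ w₃ h k
    refine ⟨_, hH.accessible_of_rel h₄, fun b hb => ?_, fun b hb => ?_⟩
    · obtain ⟨w₅, rfl, h₅⟩ := hH.accessible_mk_iff.1 hb
      exact hH.accessible_of_rel (hA w₅ h₅)
    · obtain ⟨w₆, rfl, h₆⟩ := hH.accessible_mk_iff.1 hb
      exact hH.accessible_of_rel (hB w₆ h₆)

/-- Negated variables are falsified by definition; for positive ones it suffices that variables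
transfer along equalities and that `H` has no axiom. Compound formulae never need to be transferred.
-/
def valuation (p : ℕ) : Set (Quotient hH.setoid) :=
  {a | ∃ w, Quotient.mk hH.setoid w = a ∧ .fml w (.nvar p) ∈ H}

/-- Every labelled formula in a saturated set is false in its model. -/
theorem not_sat (φ : Formula n) (w : Label) (h : .fml w φ ∈ H) :
    ¬ Sat hH.frame hH.valuation (Quotient.mk _ w) φ := by
  induction φ generalizing w with
  | var p =>
    rintro ⟨u, hu, hn⟩
    exact hH.not_axiom u p (hH.subVar w u p (hH.mk_eq.1 hu.symm) h) hn
  | nvar p => exact fun hs => hs ⟨w, rfl, h⟩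
  | and φ ψ ihφ ihψ =>
    rintro ⟨h₁, h₂⟩
    rcases hH.reduced _ h trivial with h | h
    · exact ihφ w h h₁
    · exact ihψ w h h₂
  | or φ ψ ihφ ihψ =>
    obtain ⟨h₁, h₂⟩ := hH.reduced _ h trivial
    rintro (h | h)
    · exact ihφ w h₁ h
    · exact ihψ w h₂ h
  | nec α φ ih =>
    obtain ⟨v, h₁, h₂⟩ := hH.reduced _ h trivial
    exact fun hs => ih v h₂ (hs _ (hH.accessible_of_rel h₁))
  | poss α φ ih =>
    rintro ⟨b, hb, hs⟩
    obtain ⟨u, rfl, hr⟩ := hH.accessible_mk_iff.1 hb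
    exact ih u (hH.poss α w u φ hr h) hs

end Saturated

end Xstit

theorem mainTheorem6 (n : ℕ) (φ : Xstit.Formula n) (hφ : Xstit.Valid φ) (x : Xstit.Label) :
    Xstit.Derivable ({Xstit.Item.fml x φ} : Xstit.Sequent n) := by
  by_contra h
  obtain ⟨H, hx, hH⟩ := Xstit.exists_saturated x φ h
  exact hH.not_sat φ x hx (hφ _ hH.frame hH.valuation _)
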